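/- Let $S=K[x_1,\dots,x_n]$ be the standard graded polynomial ring over a field $K$. For an ideal $I\subseteq S$ and $k\ge 1$ let $I^{(k)}=\bigcap_{P\in\mathrm{Ass}(I)}(I^kS_P\cap S)$ be its $k$-th symbolic power, where $\mathrm{Ass}(I)$ is the set of all associated primes of $S/I$. For a monomial ideal $I$ let $\mathcal G(I)$ be its set of minimal monomial generators; $I$ is called polymatroidal if the exponent vectors of the elements of $\mathcal G(I)$ form the set of bases (maximal elements) of a discrete polymatroid. Suppose that $I$ belongs to one of the following families: (a) polymatroidal ideals, generated in degree $2$, which are not squarefree (that is, some element of $\mathcal G(I)$ is not squarefree); (b) transversal polymatroidal ideals, that is, finite products of (not necessarily distinct) monomial prime ideals $P_F=(x_i : i\in F)$ with $\emptyset\ne F\subseteq\{1,\dots,n\}$; (c) principal Borel ideals, that is, ideals generated by all monomials $x_{j_1}\cdots x_{j_d}$ with $j_1\le i_1,\dots,j_d\le i_d$, where $1\le i_1\le\cdots\le i_d\le n$ is a given sequence. Then $I^{(k)}=I^k$ for all $k\ge 1$. In particular, for all $k\ge1$: - $\operatorname{reg} I^{(k)}=\operatorname{reg} I^k$, where $\operatorname{reg}$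 denotes the Castelnuovo–Mumford regularity; - $I^{(k)}$ has linear quotients, that is, $\mathcal G(I^{(k)})$ can be ordered as $u_1,\dots,u_m$ such that for each $i=2,\dots,m$ the ideal $(u_1,\dots,u_{i-1}):(u_i)$ is generated by variables; - and so $I^{(k)}$ is componentwise linear, that is, for every $d$ the ideal generated by the homogeneous elements of degree $d$ of $I^{(k)}$ has a linear resolution. -/

import Mathlib

noncomputable section

namespace MonomialIdeal

open MvPolynomial

/-! ### Symbolic powers -/

/-- The `k`-th symbolic power `I^(k) = ⋂_{P ∈ Ass(I)} (I^k R_P ∩ R)`, the intersection being over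
*all* associated primes of `I`, that is, of the `R`-module `R / I` (embedded ones included). -/
def symbolicPower {R : Type*} [CommRing R] (I : Ideal R) (k : ℕ) : Ideal R :=
  ⨅ (P : Ideal R) (hP : P ∈ associatedPrimes R (R ⧸ I)),
    haveI : P.IsPrime := IsAssociatedPrime.isPrime hP
    ((I ^ k).map (algebraMap R (Localization.AtPrime P))).comap
      (algebraMap R (Localization.AtPrime P))

variable {K : Type*} [Field K] {n : ℕ}

/-! ### Monomial ideals and their minimal generators

A monomial `x^a` of `K[x_1, …, x_n]` is represented by its exponent vector `a : Fin n →₀ ℕ`. -/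

/-- The ideal generated by the monomials with exponent vectors in `A`. -/
def spanMonomials (K : Type*) [Field K] {n : ℕ} (A : Set (Fin n →₀ ℕ)) :
    Ideal (MvPolynomial (Fin n) K) :=
  Ideal.span ((fun a => monomial a (1 : K)) '' A)

/-- `I` is generated by monomials. -/
def IsMonomialIdeal (I : Ideal (MvPolynomial (Fin n) K)) : Prop :=
  ∃ A : Set (Fin n →₀ ℕ), I = spanMonomials K A

/-- The exponent vectors of the minimal monomial generators `𝒢(I)` of a monomial ideal: the
monomials of `I` that are minimal with respect to divisibility. -/
def minGens (I : Ideal (MvPolynomial (Fin n) K)) : Set (Fin n →₀ ℕ) :=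
  {a | Minimal (fun b => monomial b (1 : K) ∈ I) a}

/-- All minimal monomial generators of `I` have degree `d`. -/
def IsGeneratedInDegree (I : Ideal (MvPolynomial (Fin n) K)) (d : ℕ) : Prop :=
  ∀ a ∈ minGens I, a.degree = d

/-- All minimal monomial generators of `I` are squarefree. -/
def IsSquarefreeIdeal (I : Ideal (MvPolynomial (Fin n) K)) : Prop :=
  ∀ a ∈ minGens I, ∀ i, a i ≤ 1

/-! ### Polymatroidal ideals -/

/-- A discrete polymatroid on the ground set `Fin n`: a non-empty finite set `P` of vectors with
non-negative integer entries which contains every vector below one of its members, and such that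
whenever `u, v ∈ P` and `|u| < |v|`, there is `i` with `u_i < v_i` and `u + e_i ∈ P`. -/
structure IsDiscretePolymatroid (P : Set (Fin n →₀ ℕ)) : Prop where
  nonempty : P.Nonempty
  finite : P.Finite
  mem_of_le : ∀ v ∈ P, ∀ u, u ≤ v → u ∈ P
  augment : ∀ u ∈ P, ∀ v ∈ P, u.degree < v.degree →
    ∃ i, u i < v i ∧ u + Finsupp.single i 1 ∈ P

/-- A monomial ideal is polymatroidal if the exponent vectors of its minimal monomial generators
form the set of bases (the maximal members) of a discrete polymatroid. -/
def IsPolymatroidal (I : Ideal (MvPolynomial (Fin n) K)) : Prop :=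
  IsMonomialIdeal I ∧
    ∃ P : Set (Fin n →₀ ℕ), IsDiscretePolymatroid P ∧ minGens I = {a | Maximal (· ∈ P) a}

/-- The monomial prime ideal `P_F = (x_i : i ∈ F)`. -/
def monomialPrime (K : Type*) [Field K] {n : ℕ} (F : Finset (Fin n)) :
    Ideal (MvPolynomial (Fin n) K) :=
  Ideal.span ((fun i => (X i : MvPolynomial (Fin n) K)) '' (F : Set (Fin n)))

/-- A transversal polymatroidal ideal: a product of finitely many (not necessarily distinct)
monomial prime ideals `P_F`, `F` non-empty. -/
def IsTransversal (I : Ideal (MvPolynomial (Fin n) K)) : Prop :=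
  ∃ (t : ℕ) (F : Fin t → Finset (Fin n)), (∀ s, (F s).Nonempty) ∧ I = ∏ s, monomialPrime K (F s)

/-- The principal Borel ideal `B(u)` of `u = x_{i_1} ⋯ x_{i_d}`, where `i_1 ≤ ⋯ ≤ i_d`: it is
generated by the monomials `x_{j_1} ⋯ x_{j_d}` with `j_1 ≤ i_1, …, j_d ≤ i_d`. (These all have
degree `d`, so they are the minimal monomial generators.) -/
def principalBorel (K : Type*) [Field K] {n d : ℕ} (i : Fin d → Fin n) :
    Ideal (MvPolynomial (Fin n) K) :=
  Ideal.span {f | ∃ j : Fin d → Fin n, (∀ l, j l ≤ i l) ∧ f = ∏ l, X (j l)}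

/-- `I = B(u)` for some monomial `u`. -/
def IsPrincipalBorel (I : Ideal (MvPolynomial (Fin n) K)) : Prop :=
  ∃ (d : ℕ) (i : Fin d → Fin n), Monotone i ∧ I = principalBorel K i

/-! ### Linear quotients -/

/-- A monomial ideal `I` has linear quotients if `𝒢(I)` can be ordered as `u_1, …, u_m` such that
for each `s = 2, …, m` the ideal `(u_1, …, u_{s-1}) : (u_s)` is generated by variables. -/
def HasLinearQuotients (I : Ideal (MvPolynomial (Fin n) K)) : Prop :=
  IsMonomialIdeal I ∧
    ∃ (m : ℕ) (u : Fin m → (Fin n →₀ ℕ)), Function.Injective u ∧ Set.range u = minGens I ∧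
      ∀ s : Fin m, 0 < (s : ℕ) → ∃ F : Finset (Fin n),
        (spanMonomials K (u '' {r | r < s})).colon
            (spanMonomials K {u s} : Set (MvPolynomial (Fin n) K)) =
          monomialPrime K F

/-! ### Graded free resolutions, regularity, componentwise linearity -/

/-- A graded free resolution `⋯ → F_2 → F_1 → F_0 → I → 0` of an ideal `I` of the standard graded
polynomial ring `S`, where `F_i = ⨁_p S(-shift i p)` has finite rank `rank i`. The maps are
homogeneous of degree `0`: `F_0 → I` sends the `p`-th basis element to `aug p`, homogeneous of
degree `shift 0 p`, and every entry `diff i p q` of the matrix of `F_{i+1} → F_i` is homogeneous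
of degree `shift (i+1) q - shift i p` (so it is zero if this number is negative). -/
structure GradedFreeResolution (I : Ideal (MvPolynomial (Fin n) K)) where
  rank : ℕ → ℕ
  shift : (i : ℕ) → Fin (rank i) → ℕ
  aug : Fin (rank 0) → MvPolynomial (Fin n) K
  diff : (i : ℕ) → Matrix (Fin (rank i)) (Fin (rank (i + 1))) (MvPolynomial (Fin n) K)
  aug_homogeneous : ∀ p, (aug p).IsHomogeneous (shift 0 p)
  diff_homogeneous : ∀ i p q, ∀ a ∈ (diff i p q).support, shift i p + a.degree = shift (i + 1) q
  range_aug : LinearMap.range (Fintype.linearCombination (MvPolynomial (Fin n) K) aug) = I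
  exact_zero :
    Function.Exact (diff 0).mulVecLin (Fintype.linearCombination (MvPolynomial (Fin n) K) aug)
  exact_succ : ∀ i, Function.Exact (diff (i + 1)).mulVecLin (diff i).mulVecLin

/-- The resolution is minimal: the image of `F_{i+1} → F_i` lies in `𝔪 F_i` for all `i`, where
`𝔪 = (x_1, …, x_n)`; that is, all matrix entries have zero constant term. -/
def GradedFreeResolution.IsMinimal {I : Ideal (MvPolynomial (Fin n) K)}
    (F : GradedFreeResolution I) : Prop :=
  ∀ i p q, constantCoeff (F.diff i p q) = 0

/-- The Castelnuovo-Mumford regularity `reg I = max {a_{ip} - i}`, where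
`F_i = ⨁_p S(-a_{ip})` are the modules of the minimal graded free resolution of `I`. The minimal
resolution of a homogeneous ideal exists and is unique up to isomorphism, so it makes no difference
that the supremum is taken over all of them; it is an integer if `I ≠ 0`, and `-∞` if `I = 0`. -/
def regularity (I : Ideal (MvPolynomial (Fin n) K)) : EReal :=
  ⨆ (F : GradedFreeResolution I) (_ : F.IsMinimal) (i : ℕ) (p : Fin (F.rank i)),
    (((F.shift i p : ℝ) - (i : ℝ) : ℝ) : EReal)

/-- `I` has a `d`-linear resolution for some `d`: in the minimal graded free resolution of `I`,
`F_i` is a direct sum of copies of `S(-(d + i))` for all `i`. -/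
def HasLinearResolution (I : Ideal (MvPolynomial (Fin n) K)) : Prop :=
  ∃ (d : ℕ) (F : GradedFreeResolution I), F.IsMinimal ∧ ∀ i p, F.shift i p = d + i

/-- The ideal `I_⟨d⟩` generated by the homogeneous elements of degree `d` of `I`. -/
def degreeComponent (I : Ideal (MvPolynomial (Fin n) K)) (d : ℕ) :
    Ideal (MvPolynomial (Fin n) K) :=
  Ideal.span {f | f ∈ I ∧ f.IsHomogeneous d}

/-- A homogeneous ideal `I` is componentwise linear if `I_⟨d⟩` has a linear resolution for
every `d`. -/
def IsComponentwiseLinear (I : Ideal (MvPolynomial (Fin n) K)) : Prop :=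
  (∀ f ∈ I, ∀ d : ℕ, homogeneousComponent d f ∈ I) ∧
    ∀ d : ℕ, HasLinearResolution (degreeComponent I d)

end MonomialIdeal

end

noncomputable section
namespace MonomialIdeal
open MvPolynomial
variable {K : Type*} [Field K] {n : ℕ}

/-! ### Ideals spanned by monomials -/

/-! Two properties of `I` carry the proof.

Equality of powers. `I` is a product of blocks (`IsBlock`) in pairwise disjoint sets of variables.
The generators of a block `J` on `G` all have degree `e + 1`, and some monomial `x^f` of degree `e`
is multiplied into `J` by every variable of `G`. Multiplying `x^f` by a monomial from the other
blocks gives an element with annihilator `P_G` modulo `I`, so `P_G` is associated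
(`IsBlock.mem_associatedPrimes`). Elements outside `P_G` are nonzerodivisors modulo `J^k`
(`mem_of_mul_mem_spanMonomials`), hence `I^(k)` lies in every `J^k`; in disjoint variables the
intersection of these is their product `I^k`. A non-squarefree polymatroidal ideal of degree 2 is
one block, with `f` a variable whose square is a generator. A monomial prime is a block with `f =
0`, and blocks sharing a variable merge (`IsBlock.mul`), which settles transversal ideals; principal
Borel ideals are transversal.

Linearity. `I` is spanned by an exchange set. Such sets are closed under Minkowski sums
(`IsExchangeSet.add`), so powers and degree components are again of this kind. Descending
lexicographic order gives linear quotients, and iterated mapping cones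
(`LinearResolution.nonempty_sup_span`) turn these into linear resolutions. -/

theorem mem_spanMonomials_iff {A : Set (Fin n →₀ ℕ)} {f : MvPolynomial (Fin n) K} :
    f ∈ spanMonomials K A ↔ ∀ a ∈ f.support, ∃ b ∈ A, b ≤ a :=
  mem_ideal_span_monomial_image

theorem monomial_mem_spanMonomials_iff {A : Set (Fin n →₀ ℕ)} {a : Fin n →₀ ℕ} :
    monomial a (1 : K) ∈ spanMonomials K A ↔ ∃ b ∈ A, b ≤ a := by
  classical
  rw [mem_spanMonomials_iff]
  simp [support_monomial]

theorem monomial_mem_spanMonomials {A : Set (Fin n →₀ ℕ)} {a : Fin n →₀ ℕ} (ha : a ∈ A) :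
    monomial a (1 : K) ∈ spanMonomials K A :=
  Ideal.subset_span ⟨a, ha, rfl⟩

theorem spanMonomials_mul (A B : Set (Fin n →₀ ℕ)) :
    spanMonomials K A * spanMonomials K B = spanMonomials K (Set.image2 (· + ·) A B) := by
  rw [spanMonomials, spanMonomials, Ideal.span_mul_span', spanMonomials, ← Set.image2_mul,
    Set.image2_image_left, Set.image2_image_right, Set.image_image2]
  simp [monomial_mul]

theorem spanMonomials_zero : spanMonomials K ({0} : Set (Fin n →₀ ℕ)) = 1 := by
  rw [spanMonomials, Set.image_singleton, Ideal.one_eq_top]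
  exact Ideal.span_singleton_one

theorem spanMonomials_insert (a : Fin n →₀ ℕ) (A : Set (Fin n →₀ ℕ)) :
    spanMonomials K (insert a A) = spanMonomials K A ⊔ Ideal.span {monomial a (1 : K)} := by
  rw [spanMonomials, Set.image_insert_eq, Ideal.span_insert, sup_comm]; rfl

theorem monomialPrime_eq_spanMonomials (F : Finset (Fin n)) :
    monomialPrime K F = spanMonomials K ((fun i => Finsupp.single i 1) '' (F : Set (Fin n))) := by
  rw [monomialPrime, spanMonomials, Set.image_image]; rfl

theorem mem_monomialPrime_iff {F : Finset (Fin n)} {f : MvPolynomial (Fin n) K} :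
    f ∈ monomialPrime K F ↔ ∀ a ∈ f.support, ∃ i ∈ F, a i ≠ 0 :=
  mem_ideal_span_X_image

theorem mul_monomial_mem_spanMonomials_iff {A : Set (Fin n →₀ ℕ)} {u : Fin n →₀ ℕ}
    {f : MvPolynomial (Fin n) K} :
    f * monomial u 1 ∈ spanMonomials K A ↔ ∀ a ∈ f.support, ∃ b ∈ A, b ≤ a + u := by
  rw [mem_spanMonomials_iff]
  constructor
  · intro h a ha
    refine h _ ?_
    rw [mem_support_iff, coeff_mul_monomial, mul_one]
    exact mem_support_iff.mp ha
  · intro h c hc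
    rw [mem_support_iff, coeff_mul_monomial'] at hc
    split_ifs at hc with hle
    · obtain ⟨b, hb, hle'⟩ := h (c - u) (mem_support_iff.mpr (by simpa using hc))
      exact ⟨b, hb, by rwa [tsub_add_cancel_of_le hle] at hle'⟩
    · exact absurd rfl hc

theorem mem_colon_spanMonomials_iff {A : Set (Fin n →₀ ℕ)} {u : Fin n →₀ ℕ}
    {f : MvPolynomial (Fin n) K} :
    f ∈ (spanMonomials K A).colon (spanMonomials K {u} : Set (MvPolynomial (Fin n) K)) ↔
      f * monomial u 1 ∈ spanMonomials K A := by
  rw [Submodule.mem_colon]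
  constructor
  · intro h
    exact h _ (monomial_mem_spanMonomials rfl)
  · intro h s hs
    rw [SetLike.mem_coe, spanMonomials, Set.image_singleton, Ideal.mem_span_singleton] at hs
    obtain ⟨t, rfl⟩ := hs
    rw [smul_eq_mul, ← mul_assoc]
    exact Ideal.mul_mem_right _ _ h

theorem degree_eq_of_le_of_degree_eq {a b : Fin n →₀ ℕ} (h : a ≤ b) (hd : b.degree ≤ a.degree) :
    a = b := by
  obtain ⟨c, rfl⟩ := exists_add_of_le h
  rw [map_add] at hd
  have : c.degree = 0 := by omega
  rw [Finsupp.degree_eq_zero_iff] at this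
  simp [this]

theorem minGens_spanMonomials {A : Set (Fin n →₀ ℕ)} {d : ℕ} (hA : ∀ a ∈ A, a.degree = d) :
    minGens (spanMonomials K A) = A := by
  ext a
  simp only [minGens, Set.mem_ofPred_eq, monomial_mem_spanMonomials_iff]
  constructor
  · rintro ⟨⟨b, hb, hba⟩, hmin⟩
    rwa [le_antisymm (hmin ⟨b, hb, le_rfl⟩ hba) hba]
  · intro ha
    refine ⟨⟨a, ha, le_rfl⟩, ?_⟩
    rintro c ⟨b, hb, hbc⟩ hca
    have : b = a := degree_eq_of_le_of_degree_eq (hbc.trans hca) (by rw [hA a ha, hA b hb])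
    rwa [this] at hbc

theorem IsMonomialIdeal.eq_spanMonomials_minGens {I : Ideal (MvPolynomial (Fin n) K)}
    (hI : IsMonomialIdeal I) : I = spanMonomials K (minGens I) := by
  obtain ⟨A, hA⟩ := hI
  refine le_antisymm ?_ ?_
  · intro f hf
    rw [mem_spanMonomials_iff]
    intro a ha
    rw [hA, mem_spanMonomials_iff] at hf
    have hmem : monomial a (1 : K) ∈ I := by
      rw [hA, monomial_mem_spanMonomials_iff]
      exact hf a ha
    obtain ⟨b, hba, hb⟩ := exists_minimal_le_of_wellFoundedLT
      (fun b => monomial b (1 : K) ∈ I) a hmem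
    exact ⟨b, hb, hba⟩
  · rw [spanMonomials, Ideal.span_le]
    rintro _ ⟨a, ha, rfl⟩
    exact ha.1

/-- An ideal spanned by monomials in the variables of `F` has only nonzerodivisors outside
`P_F`. -/
theorem mem_of_mul_mem_spanMonomials {A : Set (Fin n →₀ ℕ)} {F : Finset (Fin n)}
    (hA : ∀ a ∈ A, ∀ i ∉ F, a i = 0) {s f : MvPolynomial (Fin n) K}
    (hs : s ∉ monomialPrime K F) (hsf : s * f ∈ spanMonomials K A) : f ∈ spanMonomials K A := by
  classical
  by_contra hf
  -- Grade by degree in the variables of `F`: `s ∉ P_F` means that `s` has a term of degree 0, and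
  -- such a term does not affect divisibility by monomials of `A`.
  let deg : (Fin n →₀ ℕ) → ℕ := fun a => ∑ i ∈ F, a i
  have hdeg_add : ∀ a b, deg (a + b) = deg a + deg b := fun a b => by
    simp [deg, Finset.sum_add_distrib]
  have hle : ∀ a, deg a = 0 → ∀ b, ∀ c ∈ A, c ≤ a + b → c ≤ b := by
    intro a ha b c hc hcab i
    by_cases hi : i ∈ F
    · have h1 := hcab i
      have h2 := Finset.sum_eq_zero_iff.mp ha i hi
      rw [Finsupp.add_apply] at h1
      omega
    · rw [hA c hc i hi]
      exact Nat.zero_le _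
  rw [mem_monomialPrime_iff] at hs
  rw [mem_spanMonomials_iff] at hf hsf
  push Not at hs hf
  obtain ⟨a₁, ha₁, ha₁'⟩ := hs
  let T := f.support.filter fun b => ∀ c ∈ A, ¬ c ≤ b
  have hT : T.Nonempty := by
    obtain ⟨b, hb, hb'⟩ := hf
    exact ⟨b, Finset.mem_filter.mpr ⟨hb, hb'⟩⟩
  obtain ⟨b₁, hb₁, hmin⟩ := T.exists_min_image deg hT
  -- Choose a term of `s` of degree 0 and a term of `f` outside the ideal of least degree whose sum
  -- of exponents arises only once among such pairs. All other pairs contributing to that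
  -- coefficient are excluded by minimality, so it does not cancel.
  obtain ⟨a, ha, b, hb, huniq⟩ := UniqueSums.uniqueAdd_of_nonempty
    (A := s.support.filter fun a => deg a = 0) (B := T.filter fun b => deg b = deg b₁)
    ⟨a₁, Finset.mem_filter.mpr ⟨ha₁, Finset.sum_eq_zero ha₁'⟩⟩
    ⟨b₁, Finset.mem_filter.mpr ⟨hb₁, rfl⟩⟩
  obtain ⟨ha, ha0⟩ := Finset.mem_filter.mp ha
  obtain ⟨hb, hbm⟩ := Finset.mem_filter.mp hb
  obtain ⟨hb, hbA⟩ := Finset.mem_filter.mp hb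
  have hcoeff : coeff (a + b) (s * f) = coeff a s * coeff b f := by
    rw [coeff_mul]
    refine Finset.sum_eq_single (a, b) ?_  fun h => by simp at h
    rintro ⟨c, e⟩ hce hne
    have hce : c + e = a + b := by simpa using hce
    by_contra hprod
    have hc := mem_support_iff.mpr (left_ne_zero_of_mul hprod)
    have he := mem_support_iff.mpr (right_ne_zero_of_mul hprod)
    have heT : e ∈ T := Finset.mem_filter.mpr ⟨he, fun g hg hge =>
      hbA g hg (hle a ha0 b g hg (hge.trans (hce ▸ le_add_self)))⟩
    have h1 := hmin e heT
    have h2 := congrArg deg hce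
    simp only [hdeg_add] at h2
    have hc0 : deg c = 0 := by omega
    have hem : deg e = deg b₁ := by omega
    obtain ⟨rfl, rfl⟩ := huniq (Finset.mem_filter.mpr ⟨hc, hc0⟩)
      (Finset.mem_filter.mpr ⟨heT, hem⟩) hce
    exact hne rfl
  obtain ⟨c, hc, hcab⟩ := hsf (a + b) (by
    rw [mem_support_iff, hcoeff]
    exact mul_ne_zero (mem_support_iff.mp ha) (mem_support_iff.mp hb))
  exact hbA c hc (hle a ha0 b c hc hcab)

/-- `P_F` is itself spanned by monomials in the variables of `F`, so the cancellation property just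
proved, applied to `P_F`, is primality. -/
theorem isPrime_monomialPrime (F : Finset (Fin n)) : (monomialPrime K F).IsPrime := by
  refine ⟨?_, fun {s f} h => ?_⟩
  · rw [Ideal.ne_top_iff_one, mem_monomialPrime_iff]
    simp
  · by_contra! hsf
    rw [monomialPrime_eq_spanMonomials F] at h
    refine hsf.2 ?_
    rw [monomialPrime_eq_spanMonomials F]
    refine mem_of_mul_mem_spanMonomials ?_ hsf.1 h
    rintro _ ⟨j, hj, rfl⟩ i hi
    exact Finsupp.single_eq_of_ne (by rintro rfl; exact hi hj)

theorem X_mem_monomialPrime_iff {F : Finset (Fin n)} {i : Fin n} :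
    (X i : MvPolynomial (Fin n) K) ∈ monomialPrime K F ↔ i ∈ F := by
  classical
  rw [mem_monomialPrime_iff, support_X]
  simp [Finsupp.single_apply]

/-! ### Exchange sets -/

/-- A set of exponent vectors of degree `d` with the exchange property of the bases of a discrete
polymatroid: if `u i < v i` then `u + e_i - e_j` lies in the set for some `j` with `v j < u j`. -/
structure IsExchangeSet (B : Set (Fin n →₀ ℕ)) (d : ℕ) : Prop where
  degree_eq : ∀ u ∈ B, u.degree = d
  exchange : ∀ u ∈ B, ∀ v ∈ B, ∀ i, u i < v i →
    ∃ j, v j < u j ∧ ∃ w ∈ B, w + Finsupp.single j 1 = u + Finsupp.single i 1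

/-- The termination measure for `IsExchangeSet.add`: the excess over `y` falls at `j`, while raising
the deficient coordinate `l` by one creates no excess there. -/
theorem sum_tsub_lt_of_exchange {z z' y : Fin n →₀ ℕ} {l j : Fin n} (hl : z l < y l)
    (hj : y j < z j) (h : z' + Finsupp.single j 1 = z + Finsupp.single l 1) :
    ∑ t, (z' t - y t) < ∑ t, (z t - y t) := by
  have hlj : l ≠ j := by rintro rfl; omega
  have key : ∀ t, z' t + (if j = t then 1 else 0) = z t + (if l = t then 1 else 0) := fun t => by
    simpa [Finsupp.single_apply] using DFunLike.congr_fun h t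
  refine Finset.sum_lt_sum (fun t _ => ?_) ⟨j, Finset.mem_univ _, ?_⟩
  · have := key t
    split_ifs at this <;> subst_vars <;> omega
  · have := key j
    rw [if_pos rfl, if_neg hlj] at this
    omega

/-- Minkowski sums of exchange sets are exchange sets. -/
theorem IsExchangeSet.add {A B : Set (Fin n →₀ ℕ)} {d e : ℕ} (hA : IsExchangeSet A d)
    (hB : IsExchangeSet B e) : IsExchangeSet (Set.image2 (· + ·) A B) (d + e) := by
  refine ⟨?_, ?_⟩
  · rintro _ ⟨a, ha, b, hb, rfl⟩
    rw [map_add, hA.degree_eq a ha, hB.degree_eq b hb]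
  rintro x ⟨x₁, hx₁, x₂, hx₂, hx⟩ _ ⟨y₁, hy₁, y₂, hy₂, rfl⟩ i hi
  -- The surplus unit starts at `i` and currently sits at `l`. If `y l < x l` it may stay. Otherwise
  -- one summand is deficient at `l`; an exchange inside it moves the unit to another coordinate and
  -- lowers the total excess.
  have main : ∀ (N : ℕ) (l : Fin n), ∀ z₁ ∈ A, ∀ z₂ ∈ B,
      z₁ + z₂ + Finsupp.single l 1 = x + Finsupp.single i 1 →
      ∑ t, (z₁ t - y₁ t) + ∑ t, (z₂ t - y₂ t) ≤ N →
      ∃ j, (y₁ + y₂) j < x j ∧ ∃ w ∈ Set.image2 (· + ·) A B,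
        w + Finsupp.single j 1 = x + Finsupp.single i 1 := by
    intro N
    induction N with
    | zero | succ N ih =>
      intro l z₁ hz₁ z₂ hz₂ hz hN
      by_cases hl : (y₁ + y₂) l < x l
      · exact ⟨l, hl, _, ⟨z₁, hz₁, z₂, hz₂, rfl⟩, hz⟩
      have hzl : z₁ l + z₂ l < y₁ l + y₂ l := by
        have := DFunLike.congr_fun hz l
        simp only [Finsupp.add_apply, Finsupp.single_apply, if_true] at this hl hi
        split_ifs at this with hil
        · subst hil; omega
        · omega
      rcases (by omega : z₁ l < y₁ l ∨ z₂ l < y₂ l) with h | h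
      · obtain ⟨j, hj, w, hw, hwz⟩ := hA.exchange z₁ hz₁ y₁ hy₁ l h
        have hlt := sum_tsub_lt_of_exchange h hj hwz
        -- For `N = 0` the strict drop is already contradictory; otherwise recurse with the unit at
        -- `j`.
        first
          | omega
          | refine ih j w hw z₂ hz₂ ?_ (by omega)
            rw [← hz, add_right_comm, hwz, add_right_comm]
      · obtain ⟨j, hj, w, hw, hwz⟩ := hB.exchange z₂ hz₂ y₂ hy₂ l h
        have hlt := sum_tsub_lt_of_exchange h hj hwz
        first
          | omega
          | refine ih j z₁ hz₁ w hw ?_ (by omega)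
            rw [← hz, add_assoc, hwz, add_assoc]
  exact main _ i x₁ hx₁ x₂ hx₂ (by rw [← hx]) le_rfl

theorem isExchangeSet_singleton_zero : IsExchangeSet ({0} : Set (Fin n →₀ ℕ)) 0 := by
  constructor
  · rintro _ rfl
    exact map_zero _
  · rintro _ rfl _ rfl i hi
    exact absurd hi (lt_irrefl _)

theorem isExchangeSet_single (F : Finset (Fin n)) :
    IsExchangeSet ((fun i => Finsupp.single i 1) '' (F : Set (Fin n))) 1 := by
  constructor
  · rintro _ ⟨i, -, rfl⟩
    exact Finsupp.degree_single _ _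
  · rintro _ ⟨a, -, rfl⟩ _ ⟨b, hb, rfl⟩ i hi
    have hib : b = i ∧ a ≠ i := by
      simp only [Finsupp.single_apply] at hi
      split_ifs at hi <;> simp_all
    obtain ⟨rfl, hab⟩ := hib
    refine ⟨a, ?_, _, ⟨b, hb, rfl⟩, add_comm _ _⟩
    simp [hab.symm]

theorem isExchangeSet_degree (k : ℕ) : IsExchangeSet {a : Fin n →₀ ℕ | a.degree = k} k := by
  refine ⟨fun _ h => h, fun u hu v hv i hi => ?_⟩
  rw [Set.mem_ofPred_eq, Finsupp.degree_eq_sum] at hu hv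
  obtain ⟨j, -, hj⟩ : ∃ j ∈ Finset.univ, v j < u j := by
    by_contra! h
    exact absurd (Finset.sum_lt_sum h ⟨i, Finset.mem_univ _, hi⟩) (by omega)
  have hle : Finsupp.single j 1 ≤ u + Finsupp.single i 1 := by
    rw [Finsupp.single_le_iff, Finsupp.add_apply]
    omega
  refine ⟨j, hj, u + Finsupp.single i 1 - Finsupp.single j 1, ?_, tsub_add_cancel_of_le hle⟩
  have := congrArg Finsupp.degree (tsub_add_cancel_of_le hle)
  rw [map_add, map_add, Finsupp.degree_single, Finsupp.degree_single, Finsupp.degree_eq_sum u,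
    hu] at this
  exact Nat.add_right_cancel this

theorem IsExchangeSet.finite {B : Set (Fin n →₀ ℕ)} {d : ℕ} (hB : IsExchangeSet B d) :
    B.Finite :=
  (Finsupp.finite_of_degree_le d).subset fun a ha => (hB.degree_eq a ha).le

/-- In lexicographic order, everything preceding a member of an exchange set is divided, away from
that member, by a variable coming from a single exchange. -/
theorem IsExchangeSet.exists_lex_gt {B : Set (Fin n →₀ ℕ)} {d : ℕ} (hB : IsExchangeSet B d)
    {u v : Fin n →₀ ℕ} (hu : u ∈ B) (hv : v ∈ B) (huv : toLex u < toLex v) :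
    ∃ i, u i < v i ∧ ∃ w ∈ B, toLex u < toLex w ∧ w ≤ u + Finsupp.single i 1 := by
  -- `i` is the first coordinate where `u` and `v` differ. The coordinate `j` lowered by the
  -- exchange must come later, so the exchanged vector is lexicographically larger.
  obtain ⟨i, hlt, hi⟩ := huv
  obtain ⟨j, hj, w, hw, hwu⟩ := hB.exchange u hu v hv i hi
  have hij : i < j := by
    by_contra! h
    rcases h.lt_or_eq with h | rfl
    · exact hj.ne (hlt j h).symm
    · exact hj.not_gt hi
  refine ⟨i, hi, w, hw, ⟨i, fun t ht => ?_, ?_⟩, hwu ▸ le_self_add⟩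
  · have := DFunLike.congr_fun hwu t
    simpa [Finsupp.single_apply, ht.ne', (ht.trans hij).ne'] using this.symm
  · have := DFunLike.congr_fun hwu i
    simp only [Finsupp.add_apply, Finsupp.single_apply, hij.ne', if_false, if_true] at this
    show u i < w i
    omega

/-- The ideal spanned by an exchange set has linear quotients with respect to the descending
lexicographic order. -/
theorem IsExchangeSet.exists_linear_quotients {B : Set (Fin n →₀ ℕ)} {d : ℕ}
    (hB : IsExchangeSet B d) :
    ∃ (m : ℕ) (u : Fin m → (Fin n →₀ ℕ)), Function.Injective u ∧ Set.range u = B ∧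
      ∀ s : Fin m, ∃ F : Finset (Fin n),
        (spanMonomials K (u '' {r | r < s})).colon
            (spanMonomials K {u s} : Set (MvPolynomial (Fin n) K)) =
          monomialPrime K F := by
  classical
  -- The order dual makes the increasing enumeration run through `B` in descending lexicographic
  -- order.
  let e : (Fin n →₀ ℕ) ≃ (Lex (Fin n →₀ ℕ))ᵒᵈ := toLex.trans OrderDual.toDual
  let s := hB.finite.toFinset.map e.toEmbedding
  let o := s.orderEmbOfFin rfl
  let u : Fin s.card → (Fin n →₀ ℕ) := fun r => e.symm (o r)
  have hlex : ∀ r t, r < t ↔ toLex (u t) < toLex (u r) := fun r t =>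
    (o.lt_iff_lt (a := r) (b := t)).symm
  have hrange : Set.range u = B := by
    have h := s.range_orderEmbOfFin rfl
    have : Set.range u = e.symm '' Set.range o := Set.range_comp e.symm o
    rw [this, h]
    simp [s, Set.image_image]
  refine ⟨s.card, u, e.symm.injective.comp o.injective, hrange, fun t => ?_⟩
  refine ⟨Finset.univ.filter fun i => ∃ w ∈ u '' {r | r < t}, w ≤ u t + Finsupp.single i 1, ?_⟩
  have hmem : ∀ r, u r ∈ B := fun r => hrange ▸ Set.mem_range_self r
  ext f
  rw [mem_colon_spanMonomials_iff, mul_monomial_mem_spanMonomials_iff, mem_monomialPrime_iff]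
  refine forall₂_congr fun a _ => ?_
  constructor
  · rintro ⟨_, ⟨r, hr, rfl⟩, hle⟩
    obtain ⟨i, hi, w, hw, hlt, hwle⟩ := hB.exists_lex_gt (hmem t) (hmem r) ((hlex r t).mp hr)
    rw [← hrange] at hw
    obtain ⟨r', rfl⟩ := hw
    refine ⟨i, Finset.mem_filter.mpr ⟨Finset.mem_univ _, _, ⟨r', (hlex _ _).mpr hlt, rfl⟩, hwle⟩, ?_⟩
    have := hle i
    rw [Finsupp.add_apply] at this
    omega
  · rintro ⟨i, hi, hai⟩
    obtain ⟨-, w, hw, hle⟩ := Finset.mem_filter.mp hi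
    refine ⟨w, hw, hle.trans ?_⟩
    rw [add_comm]
    gcongr
    rw [Finsupp.single_le_iff]
    omega

/-! ### Ideals spanned by exchange sets -/

/-- The ideal is spanned by the monomials of an exchange set of degree `d`. -/
def IsExchangeIdeal (I : Ideal (MvPolynomial (Fin n) K)) (d : ℕ) : Prop :=
  ∃ B : Set (Fin n →₀ ℕ), IsExchangeSet B d ∧ I = spanMonomials K B

theorem IsExchangeIdeal.mul {I J : Ideal (MvPolynomial (Fin n) K)} {d e : ℕ}
    (hI : IsExchangeIdeal I d) (hJ : IsExchangeIdeal J e) : IsExchangeIdeal (I * J) (d + e) := by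
  obtain ⟨A, hA, rfl⟩ := hI
  obtain ⟨B, hB, rfl⟩ := hJ
  exact ⟨_, hA.add hB, spanMonomials_mul A B⟩

theorem isExchangeIdeal_one : IsExchangeIdeal (1 : Ideal (MvPolynomial (Fin n) K)) 0 :=
  ⟨_, isExchangeSet_singleton_zero, spanMonomials_zero.symm⟩

theorem IsExchangeIdeal.pow {I : Ideal (MvPolynomial (Fin n) K)} {d : ℕ}
    (hI : IsExchangeIdeal I d) (k : ℕ) : IsExchangeIdeal (I ^ k) (k * d) := by
  induction k with
  | zero => simpa using isExchangeIdeal_one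
  | succ k ih => simpa [pow_succ, add_mul] using ih.mul hI

theorem isExchangeIdeal_monomialPrime (F : Finset (Fin n)) :
    IsExchangeIdeal (monomialPrime K F) 1 :=
  ⟨_, isExchangeSet_single F, monomialPrime_eq_spanMonomials F⟩

theorem IsExchangeIdeal.hasLinearQuotients {I : Ideal (MvPolynomial (Fin n) K)} {d : ℕ}
    (hI : IsExchangeIdeal I d) : HasLinearQuotients I := by
  obtain ⟨B, hB, rfl⟩ := hI
  obtain ⟨m, u, hu, hr, h⟩ := hB.exists_linear_quotients (K := K)
  exact ⟨⟨B, rfl⟩, m, u, hu, hr.trans (minGens_spanMonomials hB.degree_eq).symm, fun s _ => h s⟩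

theorem IsExchangeIdeal.homogeneousComponent_mem {I : Ideal (MvPolynomial (Fin n) K)} {d : ℕ}
    (hI : IsExchangeIdeal I d) {f : MvPolynomial (Fin n) K} (hf : f ∈ I) (e : ℕ) :
    homogeneousComponent e f ∈ I := by
  obtain ⟨B, hB, rfl⟩ := hI
  rw [mem_spanMonomials_iff] at hf ⊢
  intro a ha
  rw [support_homogeneousComponent, Finset.mem_filter] at ha
  exact hf a ha.1

/-- The monomials of degree `e ≥ d` in the ideal are the Minkowski sum of `B` with all monomials of
degree `e - d`; for `e < d` there are none, and the empty set has the exchange property. -/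
theorem IsExchangeIdeal.degreeComponent {I : Ideal (MvPolynomial (Fin n) K)} {d : ℕ}
    (hI : IsExchangeIdeal I d) (e : ℕ) : IsExchangeIdeal (degreeComponent I e) e := by
  obtain ⟨B, hB, rfl⟩ := hI
  have hspan : MonomialIdeal.degreeComponent (spanMonomials K B) e =
      spanMonomials K {a | a.degree = e ∧ ∃ b ∈ B, b ≤ a} := by
    refine le_antisymm (Ideal.span_le.mpr ?_) (Ideal.span_le.mpr ?_)
    · rintro f ⟨hf, hfe⟩
      rw [SetLike.mem_coe, mem_spanMonomials_iff]
      rw [mem_spanMonomials_iff] at hf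
      refine fun a ha => ⟨a, ⟨?_, hf a ha⟩, le_rfl⟩
      have := hfe (mem_support_iff.mp ha)
      rw [Finsupp.degree_eq_weight_one]
      exact this
    · rintro _ ⟨a, ⟨ha, hb⟩, rfl⟩
      exact Ideal.subset_span ⟨monomial_mem_spanMonomials_iff.mpr hb, isHomogeneous_monomial _ ha⟩
  refine ⟨_, ?_, hspan⟩
  by_cases hde : d ≤ e
  · have := hB.add (isExchangeSet_degree (n := n) (e - d))
    rw [Nat.add_sub_cancel' hde] at this
    convert this using 1
    ext a
    constructor
    · rintro ⟨ha, b, hb, hle⟩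
      refine ⟨b, hb, a - b, ?_, add_tsub_cancel_of_le hle⟩
      have h := congrArg Finsupp.degree (add_tsub_cancel_of_le hle)
      rw [map_add, hB.degree_eq b hb, ha] at h
      show (a - b).degree = e - d
      omega
    · rintro ⟨b, hb, c, hc, rfl⟩
      exact ⟨this.degree_eq _ ⟨b, hb, c, hc, rfl⟩, b, hb, le_self_add⟩
  · convert (⟨by simp, by simp⟩ : IsExchangeSet (∅ : Set (Fin n →₀ ℕ)) e)
    rw [Set.eq_empty_iff_forall_notMem]
    rintro a ⟨ha, b, hb, hle⟩
    have := Finsupp.degree_mono hle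
    rw [hB.degree_eq b hb, ha] at this
    exact hde this

/-! ### Linear resolutions -/

open Matrix

/-- A `d`-linear free resolution of an ideal: the augmentation has entries homogeneous of degree
`d`, and all the differentials have linear entries. -/
structure LinearResolution (I : Ideal (MvPolynomial (Fin n) K)) (d : ℕ) where
  idx : ℕ → Type
  fintype : ∀ i, Fintype (idx i)
  aug : idx 0 → MvPolynomial (Fin n) K
  diff : ∀ i, Matrix (idx i) (idx (i + 1)) (MvPolynomial (Fin n) K)
  aug_homogeneous : ∀ p, (aug p).IsHomogeneous d
  diff_homogeneous : ∀ i p q, (diff i p q).IsHomogeneous 1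
  mem_iff : ∀ f, f ∈ I ↔ ∃ x, aug ⬝ᵥ x = f
  exact_zero : ∀ x, aug ⬝ᵥ x = 0 ↔ ∃ y, diff 0 *ᵥ y = x
  exact_succ : ∀ i x, diff i *ᵥ x = 0 ↔ ∃ y, diff (i + 1) *ᵥ y = x

attribute [instance] LinearResolution.fintype

theorem homogeneousComponent_add_mul {f g : MvPolynomial (Fin n) K} {a b : ℕ}
    (hf : f.IsHomogeneous a) :
    homogeneousComponent (a + b) (f * g) = f * homogeneousComponent b g := by
  let : GradedAlgebra (homogeneousSubmodule (Fin n) K) := MvPolynomial.gradedAlgebra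
  have h := DirectSum.coe_decompose_mul_add_of_left_mem (homogeneousSubmodule (Fin n) K)
    (i := a) (j := b) (a := f) (b := g) hf
  rwa [show DirectSum.decompose (homogeneousSubmodule (Fin n) K) (f * g) =
      decomposition.decompose' (f * g) from rfl,
    show DirectSum.decompose (homogeneousSubmodule (Fin n) K) g =
      decomposition.decompose' g from rfl,
    decomposition.decompose'_apply, decomposition.decompose'_apply] at h

/-- A homogeneous vector in the image of a homogeneous matrix has a homogeneous preimage. -/
theorem exists_homogeneous_mulVec_eq {l m : Type*} [Fintype m]
    {A : Matrix l m (MvPolynomial (Fin n) K)} {v : l → MvPolynomial (Fin n) K} {a b : ℕ}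
    (hA : ∀ p q, (A p q).IsHomogeneous a) (hv : ∀ p, (v p).IsHomogeneous (a + b))
    (h : ∃ y, A *ᵥ y = v) : ∃ y, (∀ q, (y q).IsHomogeneous b) ∧ A *ᵥ y = v := by
  obtain ⟨y, rfl⟩ := h
  refine ⟨fun q => homogeneousComponent b (y q),
    fun q => homogeneousComponent_isHomogeneous b (y q), ?_⟩
  ext1 p
  rw [← homogeneousComponent_eq_self (hv p)]
  simp only [mulVec, dotProduct, map_sum]
  exact Finset.sum_congr rfl fun q _ => (homogeneousComponent_add_mul (hA p q)).symm

theorem exists_homogeneous_mul_eq {l m o : Type*} [Fintype m]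
    {A : Matrix l m (MvPolynomial (Fin n) K)} {V : Matrix l o (MvPolynomial (Fin n) K)} {a b : ℕ}
    (hA : ∀ p q, (A p q).IsHomogeneous a) (hV : ∀ p q, (V p q).IsHomogeneous (a + b))
    (h : ∀ q, ∃ y, A *ᵥ y = fun p => V p q) :
    ∃ W : Matrix m o (MvPolynomial (Fin n) K), (∀ p q, (W p q).IsHomogeneous b) ∧ A * W = V := by
  choose w hw hAw using fun q => exists_homogeneous_mulVec_eq hA (fun p => hV p q) (h q)
  exact ⟨fun p q => w q p, fun p q => hw q p, by ext1 p q; exact congrFun (hAw q) p⟩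

theorem isHomogeneous_mul_apply {l m o : Type*} [Fintype m]
    {A : Matrix l m (MvPolynomial (Fin n) K)} {B : Matrix m o (MvPolynomial (Fin n) K)} {a b : ℕ}
    (hA : ∀ p q, (A p q).IsHomogeneous a) (hB : ∀ p q, (B p q).IsHomogeneous b) (p : l) (q : o) :
    ((A * B) p q).IsHomogeneous (a + b) :=
  IsHomogeneous.sum _ _ _ fun r _ => (hA p r).mul (hB r q)

/-! ### Mapping cones of multiplication by a form. -/

namespace LinearResolution

variable {I J Q : Ideal (MvPolynomial (Fin n) K)} {d : ℕ}

/-- The zero resolution of the zero ideal. -/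
def zero (d : ℕ) : LinearResolution (⊥ : Ideal (MvPolynomial (Fin n) K)) d where
  idx _ := Empty
  fintype _ := inferInstance
  aug := Empty.elim
  diff _ := 0
  aug_homogeneous p := p.elim
  diff_homogeneous _ p := p.elim
  mem_iff f := by simp [eq_comm]
  exact_zero x := ⟨fun _ => ⟨fun p => p.elim, funext fun p => p.elim⟩, fun _ => by simp⟩
  exact_succ i x := ⟨fun _ => ⟨fun p => p.elim, funext fun p => p.elim⟩, fun _ => by simp⟩

/-- The index types of the resolution of the quotient ring by `I`. -/
def quotIdx (R : LinearResolution I d) : ℕ → Type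
  | 0 => Unit
  | i + 1 => R.idx i

instance (R : LinearResolution I d) : ∀ i, Fintype (R.quotIdx i)
  | 0 => inferInstanceAs (Fintype Unit)
  | i + 1 => R.fintype i

/-- The differentials of the resolution of the quotient ring by `I`. -/
def quotDiff (R : LinearResolution I d) :
    ∀ i, Matrix (R.quotIdx i) (R.quotIdx (i + 1)) (MvPolynomial (Fin n) K)
  | 0 => fun _ p => R.aug p
  | i + 1 => R.diff i

/-- The augmentation becomes the first differential of the quotient's resolution, so the generators
must be linear forms. -/
theorem quotDiff_homogeneous (R : LinearResolution I 1) :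
    ∀ i p q, (R.quotDiff i p q).IsHomogeneous 1
  | 0, _, q => R.aug_homogeneous q
  | i + 1, p, q => R.diff_homogeneous i p q

theorem quotDiff_exact (R : LinearResolution I d) :
    ∀ i x, R.quotDiff i *ᵥ x = 0 ↔ ∃ y, R.quotDiff (i + 1) *ᵥ y = x
  | 0, x => by
    refine Iff.trans ?_ (R.exact_zero x)
    exact ⟨fun h => congrFun h (), fun h => funext fun _ => h⟩
  | i + 1, x => R.exact_succ i x

/-- The index of the basis element of the quotient ring. -/
def quotPt (R : LinearResolution I d) : R.quotIdx 0 := ()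

instance (R : LinearResolution I d) : Unique (R.quotIdx 0) := inferInstanceAs (Unique Unit)

theorem mem_iff_quotDiff (R : LinearResolution I d) (f : MvPolynomial (Fin n) K) :
    f ∈ I ↔ ∃ x, (R.quotDiff 0 *ᵥ x) R.quotPt = f :=
  R.mem_iff f

theorem quotDiff_mulVec_quotDiff (R : LinearResolution I d) (i : ℕ)
    (x : R.quotIdx (i + 2) → MvPolynomial (Fin n) K) :
    R.quotDiff i *ᵥ (R.quotDiff (i + 1) *ᵥ x) = 0 :=
  (R.quotDiff_exact i _).mpr ⟨x, rfl⟩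

/-- Multiplication by `u` lifts to a map from the resolution of `S / Q` to that of `S / J`. -/
theorem exists_lift (R : LinearResolution J d) (T : LinearResolution Q 1)
    {u : MvPolynomial (Fin n) K} (hu : u.IsHomogeneous d) (hQ : ∀ f ∈ Q, f * u ∈ J) :
    ∃ φ : ∀ i, Matrix (R.idx i) (T.quotIdx (i + 1)) (MvPolynomial (Fin n) K),
      (∀ i p q, (φ i p q).IsHomogeneous 1) ∧
      (∀ x, R.aug ⬝ᵥ (φ 0 *ᵥ x) = u * (T.quotDiff 0 *ᵥ x) T.quotPt) ∧
      ∀ i, R.diff i * φ (i + 1) = φ i * T.quotDiff (i + 1) := by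
  classical
  -- Besides linearity, each stage records that its composite with the next differential lands in
  -- the image of `R.diff i`, which is what the following stage needs in order to exist.
  let Lift : ℕ → Type _ := fun i =>
    {φ : Matrix (R.idx i) (T.quotIdx (i + 1)) (MvPolynomial (Fin n) K) //
      (∀ p q, (φ p q).IsHomogeneous 1) ∧
      ∀ x, ∃ y, R.diff i *ᵥ y = φ *ᵥ (T.quotDiff (i + 1) *ᵥ x)}
  have start : ∃ φ : Lift 0,
      ∀ x, R.aug ⬝ᵥ (φ.1 *ᵥ x) = u * (T.quotDiff 0 *ᵥ x) T.quotPt := by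
    -- The augmentation is read as a one-row matrix of degree `d`; the target row has degree `d +
    -- 1`, so the lift has linear entries.
    obtain ⟨φ, hφ, hAφ⟩ := exists_homogeneous_mul_eq (A := Matrix.of fun (_ : Unit) => R.aug)
      (V := Matrix.of fun _ q => u * T.quotDiff 0 T.quotPt q) (fun _ => R.aug_homogeneous)
      (fun _ q => hu.mul (T.quotDiff_homogeneous 0 _ q)) fun q => by
        have hq : T.quotDiff 0 T.quotPt q ∈ Q :=
          (T.mem_iff_quotDiff _).mpr ⟨Pi.single q 1, by simp⟩
        obtain ⟨y, hy⟩ := (R.mem_iff _).mp (hQ _ hq)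
        exact ⟨y, funext fun _ => hy.trans (mul_comm _ _)⟩
    have key : ∀ x, R.aug ⬝ᵥ (φ *ᵥ x) = u * (T.quotDiff 0 *ᵥ x) T.quotPt := fun x => by
      have h := congrFun (congrArg (fun M => M *ᵥ x) hAφ) ()
      rw [← mulVec_mulVec] at h
      refine h.trans ?_
      simp only [mulVec, dotProduct, Finset.mul_sum, mul_assoc, of_apply]
    refine ⟨⟨φ, hφ, fun x => ?_⟩, key⟩
    rw [← R.exact_zero, key, T.quotDiff_mulVec_quotDiff, Pi.zero_apply, mul_zero]
  have step : ∀ (i : ℕ) (φ : Lift i), ∃ ψ : Lift (i + 1),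
      R.diff i * ψ.1 = φ.1 * T.quotDiff (i + 1) := by
    rintro i ⟨φ, hφ, hex⟩
    obtain ⟨ψ, hψ, hAψ⟩ := exists_homogeneous_mul_eq (R.diff_homogeneous i)
      (isHomogeneous_mul_apply hφ (T.quotDiff_homogeneous (i + 1))) fun q => by
        obtain ⟨y, hy⟩ := hex (Pi.single q 1)
        refine ⟨y, hy.trans ?_⟩
        rw [mulVec_mulVec, mulVec_single_one]
        rfl
    refine ⟨⟨ψ, hψ, fun x => ?_⟩, hAψ⟩
    rw [← R.exact_succ, mulVec_mulVec, hAψ, ← mulVec_mulVec, T.quotDiff_mulVec_quotDiff,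
      mulVec_zero]
  obtain ⟨φ₀, hφ₀⟩ := start
  choose next hnext using step
  let c : ∀ i, Lift i := fun i => Nat.rec φ₀ next i
  exact ⟨fun i => (c i).1, fun i => (c i).2.1, hφ₀, fun i => hnext i (c i)⟩

/-- The mapping cone of multiplication by `u`. -/
theorem nonempty_sup_span (R : LinearResolution J d) (T : LinearResolution Q 1)
    {u : MvPolynomial (Fin n) K} (hu : u.IsHomogeneous d) (hQ : ∀ f, f ∈ Q ↔ f * u ∈ J) :
    Nonempty (LinearResolution (J ⊔ Ideal.span {u}) d) := by
  obtain ⟨φ, hφ, hφ0, hφs⟩ := R.exists_lift T hu fun f => (hQ f).mp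
  have haug : ∀ x : R.idx 0 ⊕ T.quotIdx 0 → MvPolynomial (Fin n) K,
      Sum.elim R.aug (fun _ => u) ⬝ᵥ x = R.aug ⬝ᵥ (x ∘ Sum.inl) + u * x (Sum.inr T.quotPt) := by
    intro x
    conv_lhs => rw [← Sum.elim_comp_inl_inr x, sumElim_dotProduct_sumElim]
    congr 1
    exact Fintype.sum_unique fun t => u * x (Sum.inr t)
  -- As `Q = J : u`, multiplication by `u` embeds `S / Q` in `S / J` with cokernel `S / (J + (u))`;
  -- this is the cone of its lift. The summand from `S / Q` begins with `S` itself, whose basis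
  -- element maps to `u`.
  refine ⟨⟨fun i => R.idx i ⊕ T.quotIdx i, fun i => inferInstance, Sum.elim R.aug fun _ => u,
    fun i => fromBlocks (R.diff i) (φ i) 0 (-T.quotDiff i), ?_, ?_, ?_, ?_, ?_⟩⟩
  · rintro (p | p)
    · exact R.aug_homogeneous p
    · exact hu
  · rintro i (p | p) (q | q)
    · exact R.diff_homogeneous i p q
    · exact hφ i p q
    · exact isHomogeneous_zero _ _ _
    · exact (T.quotDiff_homogeneous i p q).neg
  · intro f
    rw [Submodule.mem_sup]
    constructor
    · rintro ⟨g, hg, _, hh, rfl⟩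
      obtain ⟨x, rfl⟩ := (R.mem_iff g).mp hg
      obtain ⟨t, rfl⟩ := Ideal.mem_span_singleton.mp hh
      exact ⟨Sum.elim x fun _ => t, by rw [haug, Sum.elim_comp_inl, Sum.elim_inr]⟩
    · rintro ⟨x, rfl⟩
      rw [haug]
      exact ⟨_, (R.mem_iff _).mpr ⟨_, rfl⟩, _, Ideal.mem_span_singleton.mpr ⟨_, rfl⟩, rfl⟩
  · intro x
    rw [haug]
    simp only [fromBlocks_mulVec, zero_mulVec, zero_add, neg_mulVec]
    constructor
    · intro h
      have h1 : x (Sum.inr T.quotPt) ∈ Q := by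
        rw [hQ, mul_comm, ← neg_mem_iff, R.mem_iff]
        exact ⟨_, eq_neg_of_add_eq_zero_left h⟩
      obtain ⟨z, hz⟩ := (T.mem_iff_quotDiff _).mp h1
      have h2 : R.aug ⬝ᵥ (x ∘ Sum.inl + φ 0 *ᵥ z) = 0 := by
        rw [dotProduct_add, hφ0, hz, h]
      obtain ⟨w, hw⟩ := (R.exact_zero _).mp h2
      -- The sign compensates for the differential `-T.quotDiff`; the resulting term `-φ z` cancels
      -- the correction added to make the first component a cycle.
      refine ⟨Sum.elim w (-z), ?_⟩
      rw [Sum.elim_comp_inl, Sum.elim_comp_inr, mulVec_neg, mulVec_neg, neg_neg, hw,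
        add_neg_cancel_right]
      conv_rhs => rw [← Sum.elim_comp_inl_inr x]
      congr 1
      exact funext (Unique.forall_iff.mpr hz)
    · rintro ⟨y, rfl⟩
      rw [Sum.elim_comp_inl, Sum.elim_inr, dotProduct_add, (R.exact_zero _).mpr ⟨_, rfl⟩, hφ0,
        Pi.neg_apply, mul_neg, zero_add, add_neg_cancel]
  · intro i x
    simp only [fromBlocks_mulVec, zero_mulVec, zero_add, neg_mulVec]
    constructor
    · intro h
      have h1 := congrArg (· ∘ Sum.inl) h
      have h2 := congrArg (· ∘ Sum.inr) h
      simp only [Sum.elim_comp_inl, Sum.elim_comp_inr] at h1 h2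
      obtain ⟨z, hz⟩ := (T.quotDiff_exact i _).mp (neg_eq_zero.mp h2)
      have h3 : R.diff i *ᵥ (x ∘ Sum.inl + φ (i + 1) *ᵥ z) = 0 := by
        rw [mulVec_add, mulVec_mulVec, hφs, ← mulVec_mulVec, hz]
        exact h1
      obtain ⟨w, hw⟩ := (R.exact_succ i _).mp h3
      refine ⟨Sum.elim w (-z), ?_⟩
      rw [Sum.elim_comp_inl, Sum.elim_comp_inr, mulVec_neg, mulVec_neg, neg_neg, hz, hw,
        add_neg_cancel_right, Sum.elim_comp_inl_inr]
    · rintro ⟨y, rfl⟩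
      rw [Sum.elim_comp_inl, Sum.elim_comp_inr, mulVec_add, mulVec_neg, mulVec_neg,
        (R.exact_succ i _).mpr ⟨_, rfl⟩, T.quotDiff_mulVec_quotDiff, mulVec_mulVec, mulVec_mulVec,
        hφs, zero_add, add_neg_cancel, neg_neg]
      exact Sum.elim_zero_zero

end LinearResolution

theorem monomialPrime_empty : monomialPrime K (∅ : Finset (Fin n)) = ⊥ := by
  simp [monomialPrime]

/-- The Koszul complex, one variable at a time: `P_F` is prime and `x_a ∉ P_F`, so `P_F : x_a = P_F`
and the cone uses the same resolution twice. -/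
theorem nonempty_linearResolution_monomialPrime (F : Finset (Fin n)) :
    Nonempty (LinearResolution (monomialPrime K F) 1) := by
  induction F using Finset.induction_on with
  | empty =>
    rw [monomialPrime_empty]
    exact ⟨LinearResolution.zero 1⟩
  | insert a F ha ih =>
    obtain ⟨R⟩ := ih
    have h : monomialPrime K (insert a F) = monomialPrime K F ⊔ Ideal.span {X a} := by
      rw [monomialPrime, Finset.coe_insert, Set.image_insert_eq, Ideal.span_insert, sup_comm]
      rfl
    rw [h]
    refine R.nonempty_sup_span R (isHomogeneous_X K a) fun f => ⟨Ideal.mul_mem_right _ _, ?_⟩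
    intro hf
    exact ((isPrime_monomialPrime F).mem_or_mem hf).resolve_right
      (X_mem_monomialPrime_iff.not.mpr ha)

/-- An ideal with linear quotients whose generators have the same degree has a linear
resolution. -/
theorem nonempty_linearResolution_of_linear_quotients {d m : ℕ} {u : Fin m → (Fin n →₀ ℕ)}
    (hu : ∀ s, (u s).degree = d)
    (h : ∀ s : Fin m, ∃ F : Finset (Fin n),
      (spanMonomials K (u '' {r | r < s})).colon
          (spanMonomials K {u s} : Set (MvPolynomial (Fin n) K)) = monomialPrime K F) :
    Nonempty (LinearResolution (spanMonomials K (Set.range u)) d) := by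
  have main : ∀ k ≤ m,
      Nonempty (LinearResolution (spanMonomials K (u '' {r | (r : ℕ) < k})) d) := by
    intro k
    induction k with
    | zero =>
      intro _
      simpa [spanMonomials] using Nonempty.intro (LinearResolution.zero (K := K) (n := n) d)
    | succ k ih =>
      intro hk
      obtain ⟨R⟩ := ih (by omega)
      obtain ⟨F, hF⟩ := h ⟨k, hk⟩
      obtain ⟨T⟩ := nonempty_linearResolution_monomialPrime (K := K) F
      have hset : {r : Fin m | (r : ℕ) < k + 1} = insert (⟨k, hk⟩ : Fin m) {r : Fin m | (r : ℕ) < k} := by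
        ext r
        rw [Set.mem_insert_iff, Set.mem_ofPred_eq, Set.mem_ofPred_eq, Fin.ext_iff]
        dsimp only
        omega
      rw [hset, Set.image_insert_eq, spanMonomials_insert]
      refine R.nonempty_sup_span T (isHomogeneous_monomial _ (hu _)) fun f => ?_
      rw [← hF]
      exact mem_colon_spanMonomials_iff
  have := main m le_rfl
  rwa [show {r : Fin m | (r : ℕ) < m} = Set.univ from Set.eq_univ_of_forall fun r => r.2,
    Set.image_univ] at this

/-- Only a reindexing by `Fin`; minimality is automatic because linear forms have no constant term.
-/
theorem LinearResolution.hasLinearResolution {I : Ideal (MvPolynomial (Fin n) K)} {d : ℕ}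
    (R : LinearResolution I d) : HasLinearResolution I := by
  let e : ∀ i, R.idx i ≃ Fin (Fintype.card (R.idx i)) := fun i => Fintype.equivFin _
  have haug : ∀ x, Fintype.linearCombination (MvPolynomial (Fin n) K) (R.aug ∘ (e 0).symm) x =
      R.aug ⬝ᵥ (x ∘ e 0) := fun x => by
    rw [Fintype.linearCombination_apply, dotProduct, ← (e 0).sum_comp]
    simp [mul_comm]
  have hdiff : ∀ i x, ((R.diff i).submatrix (e i).symm (e (i + 1)).symm).mulVecLin x =
      (R.diff i *ᵥ (x ∘ e (i + 1))) ∘ (e i).symm := fun i x => by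
    rw [mulVecLin_apply, submatrix_mulVec_equiv, Equiv.symm_symm]
  have hrange : ∀ i x, x ∈ Set.range
      ((R.diff i).submatrix (e i).symm (e (i + 1)).symm).mulVecLin ↔
        ∃ y, R.diff i *ᵥ y = x ∘ e i := fun i x => by
    constructor
    · rintro ⟨y, rfl⟩
      exact ⟨_, by rw [hdiff, Function.comp_assoc, Equiv.symm_comp_self, Function.comp_id]⟩
    · rintro ⟨y, hy⟩
      refine ⟨y ∘ (e (i + 1)).symm, ?_⟩
      rw [hdiff, Function.comp_assoc, Equiv.symm_comp_self, Function.comp_id, hy,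
        Function.comp_assoc, Equiv.self_comp_symm, Function.comp_id]
  refine ⟨d, {
    rank := fun i => Fintype.card (R.idx i)
    shift := fun i _ => d + i
    aug := R.aug ∘ (e 0).symm
    diff := fun i => (R.diff i).submatrix (e i).symm (e (i + 1)).symm
    aug_homogeneous := fun p => R.aug_homogeneous _
    diff_homogeneous := ?_
    range_aug := ?_
    exact_zero := ?_
    exact_succ := ?_ }, ?_, fun _ _ => rfl⟩
  · intro i p q a ha
    have := R.diff_homogeneous i _ _ (mem_support_iff.mp ha)
    rw [add_assoc, Finsupp.degree_eq_weight_one]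
    exact congrArg (fun t => d + (i + t)) this
  · ext f
    rw [LinearMap.mem_range, R.mem_iff]
    constructor
    · rintro ⟨x, rfl⟩
      exact ⟨_, (haug x).symm⟩
    · rintro ⟨x, rfl⟩
      refine ⟨x ∘ (e 0).symm, ?_⟩
      rw [haug, Function.comp_assoc, Equiv.symm_comp_self, Function.comp_id]
  · intro x
    rw [haug, hrange, R.exact_zero]
  · intro i x
    rw [hdiff, hrange, ← R.exact_succ]
    constructor
    · intro h
      have := congrArg (· ∘ e i) h
      simpa only [Function.comp_assoc, Equiv.symm_comp_self, Function.comp_id,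
        Pi.zero_comp] using this
    · intro h
      rw [h]
      rfl
  · intro i p q
    exact (R.diff_homogeneous i _ _).coeff_eq_zero (by simp)

theorem IsExchangeIdeal.hasLinearResolution {I : Ideal (MvPolynomial (Fin n) K)} {d : ℕ}
    (hI : IsExchangeIdeal I d) : HasLinearResolution I := by
  obtain ⟨B, hB, rfl⟩ := hI
  obtain ⟨m, u, -, rfl, h⟩ := hB.exists_linear_quotients (K := K)
  obtain ⟨R⟩ := nonempty_linearResolution_of_linear_quotients
    (fun s => hB.degree_eq _ ⟨s, rfl⟩) h
  exact R.hasLinearResolution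

theorem IsExchangeIdeal.isComponentwiseLinear {I : Ideal (MvPolynomial (Fin n) K)} {d : ℕ}
    (hI : IsExchangeIdeal I d) : IsComponentwiseLinear I :=
  ⟨fun _ hf e => hI.homogeneousComponent_mem hf e,
    fun e => (hI.degreeComponent e).hasLinearResolution⟩

/-! ### Monomial ideals supported on a set of variables -/

/-- The ideal is spanned by monomials in the variables of `G`. -/
def IsSupportedOn (J : Ideal (MvPolynomial (Fin n) K)) (G : Finset (Fin n)) : Prop :=
  ∃ A : Set (Fin n →₀ ℕ), (∀ a ∈ A, ∀ i ∉ G, a i = 0) ∧ J = spanMonomials K A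

namespace IsSupportedOn

variable {I J : Ideal (MvPolynomial (Fin n) K)} {G H : Finset (Fin n)}

theorem mono (hJ : IsSupportedOn J G) (h : G ⊆ H) : IsSupportedOn J H := by
  obtain ⟨A, hA, rfl⟩ := hJ
  exact ⟨A, fun a ha i hi => hA a ha i fun hi' => hi (h hi'), rfl⟩

theorem mul (hI : IsSupportedOn I G) (hJ : IsSupportedOn J G) : IsSupportedOn (I * J) G := by
  obtain ⟨A, hA, rfl⟩ := hI
  obtain ⟨B, hB, rfl⟩ := hJ
  refine ⟨_, ?_, spanMonomials_mul A B⟩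
  rintro _ ⟨a, ha, b, hb, rfl⟩ i hi
  rw [Finsupp.add_apply, hA a ha i hi, hB b hb i hi]

theorem one : IsSupportedOn (1 : Ideal (MvPolynomial (Fin n) K)) G :=
  ⟨{0}, by simp, spanMonomials_zero.symm⟩

theorem pow (hI : IsSupportedOn I G) (k : ℕ) : IsSupportedOn (I ^ k) G := by
  induction k with
  | zero => simpa using one
  | succ k ih => simpa [pow_succ] using ih.mul hI

theorem list_prod {L : List (Ideal (MvPolynomial (Fin n) K))} (h : ∀ J ∈ L, IsSupportedOn J G) :
    IsSupportedOn L.prod G := by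
  induction L with
  | nil => simpa using one
  | cons J L ih =>
    rw [List.prod_cons]
    exact (h J List.mem_cons_self).mul (ih fun J' hJ' => h J' (List.mem_cons_of_mem _ hJ'))

/-- A monomial divisible by two monomials in disjoint sets of variables is divisible by their
product. -/
theorem inf_le_mul (hI : IsSupportedOn I G) (hJ : IsSupportedOn J Gᶜ) : I ⊓ J ≤ I * J := by
  obtain ⟨A, hA, rfl⟩ := hI
  obtain ⟨B, hB, rfl⟩ := hJ
  rintro f ⟨hf, hf'⟩
  rw [SetLike.mem_coe, mem_spanMonomials_iff] at hf hf'
  rw [spanMonomials_mul, mem_spanMonomials_iff]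
  intro c hc
  obtain ⟨a, ha, hac⟩ := hf c hc
  obtain ⟨b, hb, hbc⟩ := hf' c hc
  refine ⟨a + b, ⟨a, ha, b, hb, rfl⟩, fun i => ?_⟩
  rw [Finsupp.add_apply]
  by_cases hi : i ∈ G
  · rw [hB b hb i (by simpa using hi), add_zero]
    exact hac i
  · rw [hA a ha i hi, zero_add]
    exact hbc i

theorem mem_of_mul_mem (hI : IsSupportedOn I G) {s f : MvPolynomial (Fin n) K}
    (hs : s ∉ monomialPrime K G) (h : s * f ∈ I) : f ∈ I := by
  obtain ⟨A, hA, rfl⟩ := hI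
  exact mem_of_mul_mem_spanMonomials hA hs h

theorem exists_monomial_mem (hI : IsSupportedOn I Gᶜ) (h : I ≠ ⊥) :
    ∃ a, monomial a (1 : K) ∈ I ∧ monomial a (1 : K) ∉ monomialPrime K G := by
  classical
  obtain ⟨A, hA, rfl⟩ := hI
  obtain ⟨a, ha⟩ : A.Nonempty := by
    by_contra! hne
    exact h (by simp [spanMonomials, hne])
  refine ⟨a, monomial_mem_spanMonomials ha, ?_⟩
  rw [mem_monomialPrime_iff]
  push Not
  exact ⟨a, by simp [support_monomial], fun i hi => hA a ha i (by simpa using hi)⟩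

end IsSupportedOn

/-! ### Products of monomial ideals having a prime of all their variables as associated prime -/

/-- `J` is spanned by monomials of the same degree `e + 1` in the variables of `G`, and there is a
monomial of degree `e` whose product with each variable of `G` is in `J`. -/
structure IsBlock (G : Finset (Fin n)) (J : Ideal (MvPolynomial (Fin n) K)) : Prop where
  nonempty : G.Nonempty
  exists_socle : ∃ (A : Set (Fin n →₀ ℕ)) (e : ℕ) (f : Fin n →₀ ℕ),
    (∀ a ∈ A, a.degree = e + 1) ∧ (∀ a ∈ A, ∀ i ∉ G, a i = 0) ∧ J = spanMonomials K A ∧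
      f.degree = e ∧ ∀ i ∈ G, monomial (f + Finsupp.single i 1) (1 : K) ∈ J

namespace IsBlock

variable {G H : Finset (Fin n)} {I J : Ideal (MvPolynomial (Fin n) K)}

theorem isSupportedOn (h : IsBlock G J) : IsSupportedOn J G := by
  obtain ⟨-, A, e, f, -, hA, hJ, -⟩ := h
  exact ⟨A, hA, hJ⟩

theorem ne_bot (h : IsBlock G J) : J ≠ ⊥ := by
  obtain ⟨⟨i, hi⟩, A, e, f, -, -, -, -, hf⟩ := h
  rintro rfl
  have := hf i hi
  rw [Ideal.mem_bot, monomial_eq_zero] at this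
  exact one_ne_zero this

theorem monomialPrime (h : G.Nonempty) : IsBlock G (monomialPrime K G) := by
  refine ⟨h, (fun i => Finsupp.single i 1) '' (G : Set (Fin n)), 0, 0, ?_, ?_,
    monomialPrime_eq_spanMonomials G, map_zero _, ?_⟩
  · rintro _ ⟨i, -, rfl⟩
    exact Finsupp.degree_single _ _
  · rintro _ ⟨j, hj, rfl⟩ i hi
    exact Finsupp.single_eq_of_ne (by rintro rfl; exact hi hj)
  · intro i hi
    rw [zero_add]
    exact X_mem_monomialPrime_iff.mpr hi

/-- Blocks with a common variable can be merged. -/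
theorem mul (hI : IsBlock G I) (hJ : IsBlock H J) (h : ¬ Disjoint G H) :
    IsBlock (G ∪ H) (I * J) := by
  obtain ⟨v, hvG, hvH⟩ := Finset.not_disjoint_iff.mp h
  obtain ⟨-, A, e, f, hA, hAG, hIA, hfe, hf⟩ := hI
  obtain ⟨-, B, e', f', hB, hBH, hJB, hfe', hf'⟩ := hJ
  -- The new socle monomial is `x^f x^f' x_v`. For a variable `x_i` of one block, `x_i` joins that
  -- block's monomial and the shared `x_v` completes the other.
  refine ⟨⟨v, Finset.mem_union_left _ hvG⟩, Set.image2 (· + ·) A B, e + e' + 1,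
    f + f' + Finsupp.single v 1, ?_, ?_, ?_, ?_, ?_⟩
  · rintro _ ⟨a, ha, b, hb, rfl⟩
    rw [map_add, hA a ha, hB b hb]
    ring
  · rintro _ ⟨a, ha, b, hb, rfl⟩ i hi
    rw [Finset.mem_union, not_or] at hi
    rw [Finsupp.add_apply, hAG a ha i hi.1, hBH b hb i hi.2]
  · rw [hIA, hJB, spanMonomials_mul]
  · rw [map_add, map_add, Finsupp.degree_single, hfe, hfe']
  · intro i hi
    rcases Finset.mem_union.mp hi with hi | hi
    · have := Ideal.mul_mem_mul (hf i hi) (hf' v hvH)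
      rw [monomial_mul, one_mul] at this
      convert this using 2
      abel_nf
    · have := Ideal.mul_mem_mul (hf v hvG) (hf' i hi)
      rw [monomial_mul, one_mul] at this
      convert this using 2
      abel_nf

/-- With `x^h ∈ I` free of the variables of `G`, the annihilator of `x^(f+h)` modulo `J * I` is
`P_G`. If some `r ∉ P_G` killed it, cancelling `r x^h` modulo `J` would put `x^f` in `J`, although
its degree is too small. -/
theorem mem_associatedPrimes (hJ : IsBlock G J) (hI : IsSupportedOn I Gᶜ) (hne : I ≠ ⊥) :
    MonomialIdeal.monomialPrime K G ∈
      associatedPrimes (MvPolynomial (Fin n) K) (MvPolynomial (Fin n) K ⧸ J * I) := by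
  have hprime := isPrime_monomialPrime (K := K) G
  obtain ⟨h, hh, hhG⟩ := hI.exists_monomial_mem hne
  have hsupp := hJ.isSupportedOn
  obtain ⟨-, A, e, f, hA, hAG, hJA, hfe, hf⟩ := hJ
  refine ⟨hprime, Ideal.Quotient.mk (J * I) (monomial (f + h) 1), ?_⟩
  -- The annihilator is already prime, so taking its radical changes nothing.
  suffices hcolon : (⊥ : Submodule (MvPolynomial (Fin n) K) (MvPolynomial (Fin n) K ⧸ J * I)).colon
      {Ideal.Quotient.mk (J * I) (monomial (f + h) 1)} = MonomialIdeal.monomialPrime K G by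
    rw [hcolon, hprime.radical]
  have hmem : ∀ r, r ∈ (⊥ : Submodule (MvPolynomial (Fin n) K)
      (MvPolynomial (Fin n) K ⧸ J * I)).colon {Ideal.Quotient.mk (J * I) (monomial (f + h) 1)} ↔
      r * monomial (f + h) 1 ∈ J * I := fun r => by
    rw [Submodule.mem_colon_singleton, Submodule.mem_bot, ← Ideal.Quotient.eq_zero_iff_mem,
      map_mul]
    rfl
  refine le_antisymm (fun r hr => ?_) (Ideal.span_le.mpr ?_)
  · rw [hmem] at hr
    by_contra hrG
    have h1 : (r * monomial h 1) * monomial f 1 ∈ J := by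
      convert Ideal.mul_le_left hr using 1
      rw [mul_assoc, monomial_mul, one_mul, add_comm]
    have h2 := hsupp.mem_of_mul_mem (fun hm => (hprime.mem_or_mem hm).elim hrG hhG) h1
    rw [hJA, monomial_mem_spanMonomials_iff] at h2
    obtain ⟨a, ha, haf⟩ := h2
    have := Finsupp.degree_mono haf
    rw [hA a ha, hfe] at this
    omega
  · rintro _ ⟨i, hi, rfl⟩
    rw [SetLike.mem_coe, hmem]
    convert Ideal.mul_mem_mul (hf i hi) hh using 1
    dsimp only
    rw [show (X i : MvPolynomial (Fin n) K) = monomial (Finsupp.single i 1) 1 from rfl,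
      monomial_mul, monomial_mul, add_right_comm, add_comm (f + h)]

end IsBlock

/-- A list of blocks, each given with its set of variables. -/
def IsBlockList (L : List (Finset (Fin n) × Ideal (MvPolynomial (Fin n) K))) : Prop :=
  ∀ b ∈ L, IsBlock b.1 b.2

/-- If the new block meets a block `c` of the list, remove `c` and insert the merged block instead;
the list gets shorter, so this terminates. -/
theorem IsBlockList.exists_disjoint_cons
    (L : List (Finset (Fin n) × Ideal (MvPolynomial (Fin n) K))) (hL : IsBlockList L)
    (hd : L.Pairwise fun b c => Disjoint b.1 c.1)
    (b : Finset (Fin n) × Ideal (MvPolynomial (Fin n) K)) (hb : IsBlock b.1 b.2) :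
    ∃ L' : List (Finset (Fin n) × Ideal (MvPolynomial (Fin n) K)), IsBlockList L' ∧
      (L'.Pairwise fun b c => Disjoint b.1 c.1) ∧
        (L'.map Prod.snd).prod = b.2 * (L.map Prod.snd).prod := by
  by_cases h : ∀ c ∈ L, Disjoint b.1 c.1
  · exact ⟨b :: L, List.forall_mem_cons.mpr ⟨hb, hL⟩, List.pairwise_cons.mpr ⟨h, hd⟩, by simp⟩
  · push Not at h
    obtain ⟨c, hc, hbc⟩ := h
    obtain ⟨s, t, rfl⟩ := List.append_of_mem hc
    have hsub : (s ++ t).Sublist (s ++ c :: t) :=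
      List.Sublist.append_left (List.sublist_cons_self c t) s
    obtain ⟨L', h1, h2, h3⟩ := IsBlockList.exists_disjoint_cons (s ++ t)
      (fun d hd => hL d (hsub.subset hd)) (hd.sublist hsub) (b.1 ∪ c.1, b.2 * c.2)
      (hb.mul (hL c hc) hbc)
    refine ⟨L', h1, h2, h3.trans ?_⟩
    simp only [List.map_append, List.map_cons, List.prod_append, List.prod_cons]
    ring
termination_by L.length
decreasing_by
  subst_vars
  simp

theorem IsBlockList.exists_disjoint {L : List (Finset (Fin n) × Ideal (MvPolynomial (Fin n) K))}
    (hL : IsBlockList L) :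
    ∃ L' : List (Finset (Fin n) × Ideal (MvPolynomial (Fin n) K)), IsBlockList L' ∧
      (L'.Pairwise fun b c => Disjoint b.1 c.1) ∧
        (L'.map Prod.snd).prod = (L.map Prod.snd).prod := by
  induction L with
  | nil => exact ⟨[], hL, List.Pairwise.nil, rfl⟩
  | cons b L ih =>
    obtain ⟨hb, hL⟩ := List.forall_mem_cons.mp hL
    obtain ⟨L', h1, h2, h3⟩ := ih hL
    obtain ⟨L'', h4, h5, h6⟩ := IsBlockList.exists_disjoint_cons L' h1 h2 b hb
    exact ⟨L'', h4, h5, by rw [h6, h3, List.map_cons, List.prod_cons]⟩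

/-! ### Symbolic powers of products of blocks -/

theorem pow_le_symbolicPower {R : Type*} [CommRing R] (I : Ideal R) (k : ℕ) :
    I ^ k ≤ symbolicPower I k :=
  le_iInf₂ fun _ _ => Ideal.le_comap_map

theorem exists_mul_mem_pow_of_mem_symbolicPower {R : Type*} [CommRing R] {I P : Ideal R} {k : ℕ}
    {f : R} (hf : f ∈ symbolicPower I k) (hP : P ∈ associatedPrimes R (R ⧸ I)) :
    ∃ s ∉ P, s * f ∈ I ^ k := by
  have : P.IsPrime := IsAssociatedPrime.isPrime hP
  have h := (Submodule.mem_iInf _).mp ((Submodule.mem_iInf _).mp hf P) hP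
  rw [Ideal.mem_comap, IsLocalization.mem_map_algebraMap_iff P.primeCompl] at h
  obtain ⟨⟨⟨g, hg⟩, s⟩, hs⟩ := h
  rw [← map_mul, IsLocalization.eq_iff_exists P.primeCompl] at hs
  obtain ⟨c, hc⟩ := hs
  refine ⟨c * s, (c * s).2, ?_⟩
  have : (c * s : R) * f = c * g := by rw [← hc]; ring
  rw [this]
  exact Ideal.mul_mem_left _ _ hg

theorem IsBlockList.mem_pow_prod {k : ℕ} {f : MvPolynomial (Fin n) K}
    {L : List (Finset (Fin n) × Ideal (MvPolynomial (Fin n) K))} (hL : IsBlockList L)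
    (hd : L.Pairwise fun b c => Disjoint b.1 c.1) (hf : ∀ b ∈ L, f ∈ b.2 ^ k) :
    f ∈ (L.map Prod.snd).prod ^ k := by
  induction L with
  | nil =>
    rw [List.map_nil, List.prod_nil, one_pow, Ideal.one_eq_top]
    trivial
  | cons b L ih =>
    obtain ⟨hb, hL⟩ := List.forall_mem_cons.mp hL
    obtain ⟨hfb, hf⟩ := List.forall_mem_cons.mp hf
    obtain ⟨hbd, hd⟩ := List.pairwise_cons.mp hd
    rw [List.map_cons, List.prod_cons, mul_pow]
    refine (hb.isSupportedOn.pow k).inf_le_mul (IsSupportedOn.pow ?_ k) ⟨hfb, ih hL hd hf⟩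
    refine IsSupportedOn.list_prod fun J hJ => ?_
    obtain ⟨c, hc, rfl⟩ := List.mem_map.mp hJ
    exact (hL c hc).isSupportedOn.mono (le_compl_iff_disjoint_left.mpr (hbd c hc))

/-- After merging, each block contributes its own associated prime, and localizing there already
forces membership in the `k`-th power of that block. -/
theorem IsBlockList.symbolicPower_eq
    {L : List (Finset (Fin n) × Ideal (MvPolynomial (Fin n) K))} (hL : IsBlockList L) (k : ℕ) :
    symbolicPower (L.map Prod.snd).prod k = (L.map Prod.snd).prod ^ k := by
  obtain ⟨L, hL, hd, heq⟩ := hL.exists_disjoint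
  rw [← heq]
  refine le_antisymm (fun f hf => hL.mem_pow_prod hd fun b hb => ?_) (pow_le_symbolicPower _ k)
  obtain ⟨s, t, rfl⟩ := List.append_of_mem hb
  have hprod : ((s ++ b :: t).map Prod.snd).prod = b.2 * ((s ++ t).map Prod.snd).prod := by
    simp only [List.map_append, List.map_cons, List.prod_append, List.prod_cons]
    ring
  have hperm : (b :: (s ++ t)).Pairwise fun b c => Disjoint b.1 c.1 :=
    (List.perm_middle.pairwise_iff fun h => h.symm).mp hd
  have hsub : ∀ c ∈ s ++ t, IsBlock c.1 c.2 := fun c hc =>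
    hL c ((List.Sublist.append_left (List.sublist_cons_self b t) s).subset hc)
  rw [hprod] at hf
  have hblock := hL b hb
  have hass := hblock.mem_associatedPrimes (I := ((s ++ t).map Prod.snd).prod)
    (IsSupportedOn.list_prod fun J hJ => by
      obtain ⟨c, hc, rfl⟩ := List.mem_map.mp hJ
      exact (hsub c hc).isSupportedOn.mono
        (le_compl_iff_disjoint_left.mpr ((List.pairwise_cons.mp hperm).1 c hc)))
    (by
      rw [← Ideal.zero_eq_bot]
      refine List.prod_ne_zero fun h0 => ?_
      obtain ⟨c, hc, h0⟩ := List.mem_map.mp h0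
      exact (hsub c hc).ne_bot h0)
  obtain ⟨r, hr, hrf⟩ := exists_mul_mem_pow_of_mem_symbolicPower hf hass
  exact (hblock.isSupportedOn.pow k).mem_of_mul_mem hr (Ideal.pow_right_mono Ideal.mul_le_left k hrf)

/-! ### Bases of discrete polymatroids -/

namespace IsDiscretePolymatroid

variable {P : Set (Fin n →₀ ℕ)} {d : ℕ}

theorem degree_le (hP : IsDiscretePolymatroid P) (hd : ∀ a, Maximal (· ∈ P) a → a.degree = d)
    {a : Fin n →₀ ℕ} (ha : a ∈ P) : a.degree ≤ d := by
  obtain ⟨b, hab, hb⟩ := hP.finite.exists_le_maximal ha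
  exact (Finsupp.degree_mono hab).trans (hd b hb).le

theorem maximal_of_degree_eq (hP : IsDiscretePolymatroid P)
    (hd : ∀ a, Maximal (· ∈ P) a → a.degree = d) {a : Fin n →₀ ℕ} (ha : a ∈ P)
    (had : a.degree = d) : Maximal (· ∈ P) a :=
  ⟨ha, fun _ hb hab => (degree_eq_of_le_of_degree_eq hab (had ▸ hP.degree_le hd hb)).ge⟩

/-- Augment towards `u` repeatedly: only coordinates still below `u` are raised, which gives the
bound by the maximum. -/
theorem exists_ge_of_degree_le (hP : IsDiscretePolymatroid P) {u : Fin n →₀ ℕ} (hu : u ∈ P) :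
    ∀ (N : ℕ) (w : Fin n →₀ ℕ), w ∈ P → w.degree + N = u.degree →
      ∃ w' ∈ P, w ≤ w' ∧ w'.degree = u.degree ∧ ∀ t, w' t ≤ max (w t) (u t) := by
  intro N
  induction N with
  | zero => exact fun w hw h => ⟨w, hw, le_rfl, h, fun t => le_max_left _ _⟩
  | succ N ih =>
    intro w hw h
    obtain ⟨i, hi, hwi⟩ := hP.augment w hw u hu (by omega)
    obtain ⟨w', hw', hle, hdeg, hmax⟩ := ih _ hwi (by rw [map_add, Finsupp.degree_single]; omega)
    refine ⟨w', hw', le_self_add.trans hle, hdeg, fun t => (hmax t).trans ?_⟩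
    rw [Finsupp.add_apply, Finsupp.single_apply]
    split_ifs with hit
    · subst hit; omega
    · simp

/-- The vector `u ⊓ v + e_i` lies below `v`, hence in `P`. Augmented towards `u` it reaches a basis
below `u + e_i` and of degree one less, that is `u + e_i - e_j`; as this basis stays above `u ⊓ v +
e_i`, the lost coordinate satisfies `v j < u j`. -/
theorem isExchangeSet (hP : IsDiscretePolymatroid P)
    (hd : ∀ a, Maximal (· ∈ P) a → a.degree = d) :
    IsExchangeSet {a | Maximal (· ∈ P) a} d := by
  refine ⟨hd, fun u hu v hv i hi => ?_⟩
  have hw : u ⊓ v + Finsupp.single i 1 ∈ P := by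
    refine hP.mem_of_le v hv.1 _ fun t => ?_
    rw [Finsupp.add_apply, Finsupp.inf_apply, Finsupp.single_apply]
    split_ifs with hit
    · subst hit; omega
    · omega
  obtain ⟨w', hw', hle, hdeg, hmax⟩ := hP.exists_ge_of_degree_le hu.1 _ _ hw
    (Nat.add_sub_cancel' ((hP.degree_le hd hw).trans (hd u hu).ge))
  have hmin : ∀ t, min (u t) (v t) + (if i = t then 1 else 0) ≤ w' t := fun t => by
    simpa [Finsupp.single_apply] using hle t
  have hwu : w' ≤ u + Finsupp.single i 1 := fun t => by
    have := hmax t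
    rw [Finsupp.add_apply, Finsupp.inf_apply, Finsupp.single_apply] at this
    rw [Finsupp.add_apply, Finsupp.single_apply]
    split_ifs at this ⊢ with hit
    · subst hit; omega
    · omega
  obtain ⟨c, hc⟩ := exists_add_of_le hwu
  have hcdeg : c.degree = 1 := by
    have := congrArg Finsupp.degree hc
    rw [map_add, map_add, Finsupp.degree_single, hdeg] at this
    omega
  obtain ⟨j, hj⟩ : ∃ j, c j ≠ 0 := by
    by_contra! h0
    rw [show c = 0 from Finsupp.ext h0, map_zero] at hcdeg
    exact zero_ne_one hcdeg
  obtain rfl : Finsupp.single j 1 = c := degree_eq_of_le_of_degree_eq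
    (Finsupp.single_le_iff.mpr (Nat.pos_of_ne_zero hj)) (by rw [hcdeg, Finsupp.degree_single])
  have hj := DFunLike.congr_fun hc j
  have hminj := hmin j
  simp only [Finsupp.add_apply, Finsupp.single_apply, if_true] at hj
  refine ⟨j, ?_, w', hP.maximal_of_degree_eq hd hw' (hdeg.trans (hd u hu)), hc.symm⟩
  split_ifs at hj hminj with hij
  · subst hij; omega
  · omega

end IsDiscretePolymatroid

/-! ### The three families -/

variable {I : Ideal (MvPolynomial (Fin n) K)}

theorem IsPolymatroidal.isExchangeSet_minGens (hI : IsPolymatroidal I) {d : ℕ}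
    (hd : IsGeneratedInDegree I d) : IsExchangeSet (minGens I) d := by
  obtain ⟨-, P, hP, heq⟩ := hI
  rw [IsGeneratedInDegree, heq] at hd
  rw [heq]
  exact hP.isExchangeSet hd

/-- A non-squarefree generator of degree 2 is some `x_i^2`. Exchanging it towards a generator
containing `x_j` can only lower coordinate `i`, so `x_i x_j ∈ I` and `x_i` is the socle monomial. -/
theorem IsPolymatroidal.exists_isBlock (hI : IsPolymatroidal I) (hd : IsGeneratedInDegree I 2)
    (hsq : ¬ IsSquarefreeIdeal I) : ∃ G, IsBlock G I := by
  classical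
  have hex := hI.isExchangeSet_minGens hd
  simp only [IsSquarefreeIdeal, not_forall, not_le] at hsq
  obtain ⟨a, ha, i, hi⟩ := hsq
  have ha2 : a = Finsupp.single i 2 :=
    (degree_eq_of_le_of_degree_eq (Finsupp.single_le_iff.mpr hi)
      (by rw [hd a ha, Finsupp.degree_single])).symm
  refine ⟨Finset.univ.filter fun j => ∃ b ∈ minGens I, b j ≠ 0,
    ⟨i, Finset.mem_filter.mpr ⟨Finset.mem_univ _, a, ha, by omega⟩⟩,
    minGens I, 1, Finsupp.single i 1, hd, ?_, hI.1.eq_spanMonomials_minGens,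
    Finsupp.degree_single _ _, ?_⟩
  · intro b hb j hj
    by_contra hbj
    exact hj (Finset.mem_filter.mpr ⟨Finset.mem_univ _, b, hb, hbj⟩)
  · intro j hj
    obtain ⟨-, b, hb, hbj⟩ := Finset.mem_filter.mp hj
    by_cases hij : j = i
    · subst hij
      rw [← Finsupp.single_add, ← ha2]
      exact ha.1
    · have haj : ∀ t, t ≠ i → a t = 0 := fun t ht => by
        rw [ha2, Finsupp.single_eq_of_ne ht]
      obtain ⟨l, hl, w, hw, hwa⟩ := hex.exchange a ha b hb j
        (by rw [haj j hij]; exact Nat.pos_of_ne_zero hbj)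
      obtain rfl : l = i := by
        by_contra hli
        rw [haj l hli] at hl
        omega
      have : w = Finsupp.single l 1 + Finsupp.single j 1 := by
        refine add_right_cancel (b := Finsupp.single l 1) ?_
        rw [hwa, ha2, add_right_comm, ← Finsupp.single_add]
      rw [← this]
      exact hw.1

/-- The indices `j_l ≤ i_l` are chosen independently, so the ideal is the product of the primes on
the initial segments up to `i_l`. -/
theorem IsPrincipalBorel.isTransversal (hI : IsPrincipalBorel I) : IsTransversal I := by
  obtain ⟨d, i, -, rfl⟩ := hI
  refine ⟨d, fun l => Finset.Iic (i l), fun l => Finset.nonempty_Iic, ?_⟩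
  simp only [monomialPrime, Ideal.prod_span, principalBorel]
  congr 1
  ext f
  rw [Set.mem_fintype_prod]
  constructor
  · rintro ⟨j, hj, rfl⟩
    exact ⟨fun l => X (j l), fun l => ⟨j l, by simpa using hj l, rfl⟩, rfl⟩
  · rintro ⟨g, hg, rfl⟩
    choose j hj hjg using hg
    exact ⟨j, fun l => by simpa using hj l, by simp only [hjg]⟩

theorem IsTransversal.exists_isExchangeIdeal (hI : IsTransversal I) :
    ∃ d, IsExchangeIdeal I d := by
  obtain ⟨t, F, -, rfl⟩ := hI
  exact Finset.prod_induction _ (fun J => ∃ d, IsExchangeIdeal J d)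
    (fun _ _ ⟨d, hd⟩ ⟨e, he⟩ => ⟨d + e, hd.mul he⟩) ⟨0, isExchangeIdeal_one⟩
    fun s _ => ⟨1, isExchangeIdeal_monomialPrime (F s)⟩

theorem IsTransversal.symbolicPower_eq (hI : IsTransversal I) (k : ℕ) :
    symbolicPower I k = I ^ k := by
  obtain ⟨t, F, hF, rfl⟩ := hI
  have hL : IsBlockList (List.ofFn fun s => (F s, monomialPrime K (F s))) := by
    intro b hb
    obtain ⟨s, rfl⟩ := (List.mem_ofFn' _ _).mp hb
    exact IsBlock.monomialPrime (hF s)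
  have := hL.symbolicPower_eq k
  rwa [List.map_ofFn, List.prod_ofFn] at this

theorem IsBlock.symbolicPower_eq {G : Finset (Fin n)} (hI : IsBlock G I) (k : ℕ) :
    symbolicPower I k = I ^ k := by
  have hL : IsBlockList [(G, I)] := by simpa [IsBlockList] using hI
  simpa using hL.symbolicPower_eq k

end MonomialIdeal

end

theorem theorem5p8 {K : Type*} [Field K] (n : ℕ) (I : Ideal (MvPolynomial (Fin n) K))
    (hI :
      (MonomialIdeal.IsPolymatroidal I ∧ MonomialIdeal.IsGeneratedInDegree I 2 ∧
          ¬ MonomialIdeal.IsSquarefreeIdeal I) ∨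
        MonomialIdeal.IsTransversal I ∨
        MonomialIdeal.IsPrincipalBorel I)
    (k : ℕ) (hk : 1 ≤ k) :
    MonomialIdeal.symbolicPower I k = I ^ k ∧
      MonomialIdeal.regularity (MonomialIdeal.symbolicPower I k) =
        MonomialIdeal.regularity (I ^ k) ∧
      MonomialIdeal.HasLinearQuotients (MonomialIdeal.symbolicPower I k) ∧
      MonomialIdeal.IsComponentwiseLinear (MonomialIdeal.symbolicPower I k) := by
  have h : (∃ d, MonomialIdeal.IsExchangeIdeal I d) ∧
      MonomialIdeal.symbolicPower I k = I ^ k := by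
    rcases hI with ⟨hI, hd, hsq⟩ | hI | hI
    · obtain ⟨G, hG⟩ := hI.exists_isBlock hd hsq
      exact ⟨⟨2, _, hI.isExchangeSet_minGens hd, hI.1.eq_spanMonomials_minGens⟩,
        hG.symbolicPower_eq k⟩
    · exact ⟨hI.exists_isExchangeIdeal, hI.symbolicPower_eq k⟩
    · exact ⟨hI.isTransversal.exists_isExchangeIdeal, hI.isTransversal.symbolicPower_eq k⟩
  obtain ⟨⟨d, hd⟩, hsymb⟩ := h
  rw [hsymb]
  exact ⟨rfl, rfl, (hd.pow k).hasLinearQuotients, (hd.pow k).isComponentwiseLinear⟩
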